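/- A groupoid is a small category in which every morphism is invertible; it is abelian if all its automorphism groups are abelian. A strictly symmetric monoidal abelian groupoid is an abelian groupoid with a symmetric monoidal structure $(\otimes, \mathrm{I}, \boldsymbol{a}, \boldsymbol{r}, \boldsymbol{c})$ (associativity, unit and symmetry constraints) such that $\boldsymbol{c}_{x,x}=\mathrm{id}_{x\otimes x}$ for every object $x$. A strictly commutative Picard category is a strictly symmetric monoidal abelian groupoid in which for every object $x$ there are an object $x^*$ and an arrow $x\otimes x^*\to \mathrm{I}$. A symmetric monoidal functor $F=(F,\varphi,\varphi_0):\mathcal{M}\to\mathcal{M}'$ has invertible structure maps $\varphi_{x,y}:Fx\otimes Fy\to F(x\otimes y)$ and $\varphi_0:\mathrm{I}'\to F\mathrm{I}$; it is a symmetric monoidal equivalence if there are a symmetric monoidal functor $F':\mathcal{M}'\to\mathcal{M}$ and monoidal natural isomorphisms $F'F\cong \mathrm{id}_{\mathcal{M}}$ and $FF'\cong \mathrm{id}_{\mathcal{M}'}$. We write $\mathcal{M}\simeq\mathcal{M}'$ if there is a symmetric monoidal equivalence $\mathcal{M}\to\mathcal{M}'$. For abelian groups $G$ (written multiplicatively)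 and $A$ (written additively), let $\mathcal{S}(G,A,0)$ be the following strictly commutative Picard category. Its objects are the elements of $G$; there are no morphisms between different objects, and the endomorphisms of each object are the elements of $A$, with composition given by addition. The tensor product is multiplication in $G$ on objects, $a\otimes b=ab$, and addition in $A$ on morphisms, $u\otimes v=u+v$; the unit object is $1\in G$; the associativity, unit and symmetry constraints are all identities. **Corollary** (Deligne, Fröhlich–Wall, Sinh). (i) For any strictly commutative Picard category $\mathcal{P}$ there exist abelian groups $G$ and $A$ and a symmetric monoidal equivalence $\mathcal{S}(G,A,0)\simeq\mathcal{P}$. (ii) For any abelian groups $G,G',A,A'$, there is a symmetric monoidal equivalence $\mathcal{S}(G,A,0)\simeq\mathcal{S}(G',A',0)$ if and only if there are isomorphisms $G\cong G'$ and $A\cong A'$. -/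

import Mathlib

open CategoryTheory MonoidalCategory

universe v v₁ v₂ u u₁ u₂

/-- A strictly symmetric (= strictly commutative) monoidal abelian groupoid: a symmetric monoidal
category in which all morphisms are invertible, all automorphism groups are abelian, and the
symmetry `x ⊗ x ⟶ x ⊗ x` is the identity for every object `x`. (In a symmetric monoidal category
the left unit constraint is determined by the symmetry and the right unit constraint.) -/
class IsStrictlySymmetricAbelianGroupoid (C : Type u) [Category.{v} C] [MonoidalCategory C]
    [SymmetricCategory C] : Prop extends IsGroupoid C where
  aut_comm : ∀ (x : C) (f g : x ⟶ x), f ≫ g = g ≫ f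
  braiding_self : ∀ x : C, (β_ x x).hom = 𝟙 (x ⊗ x)

/-- A strictly commutative Picard category: a strictly symmetric monoidal abelian groupoid in which
every object `x` has a quasi-inverse `y`, i.e. there is an arrow `x ⊗ y ⟶ 𝟙_`. -/
class IsStrictlyCommutativePicard (P : Type u) [Category.{v} P] [MonoidalCategory P]
    [SymmetricCategory P] : Prop extends IsStrictlySymmetricAbelianGroupoid P where
  exists_quasiInverse : ∀ x : P, ∃ y : P, Nonempty (x ⊗ y ⟶ 𝟙_ P)

/-- A symmetric monoidal functor `F : C ⥤ D` (`Functor.Braided`: the structure maps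
`F x ⊗ F y ⟶ F (x ⊗ y)` and `𝟙_ ⟶ F 𝟙_` are isomorphisms) is a symmetric monoidal equivalence if
there are a symmetric monoidal functor `F'` in the other direction and monoidal natural isomorphisms
from the two composites to the identity functors. -/
def IsSymmetricMonoidalEquivalence {C : Type u₁} [Category.{v₁} C] [MonoidalCategory C]
    [SymmetricCategory C] {D : Type u₂} [Category.{v₂} D] [MonoidalCategory D]
    [SymmetricCategory D] (F : C ⥤ D) [F.Braided] : Prop :=
  ∃ (F' : D ⥤ C) (_ : F'.Braided) (θ : F ⋙ F' ≅ 𝟭 C) (θ' : F' ⋙ F ≅ 𝟭 D),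
    NatTrans.IsMonoidal θ.hom ∧ NatTrans.IsMonoidal θ'.hom

/-- There is a symmetric monoidal equivalence `C ⥤ D`. -/
def SymmetricMonoidalEquivalent (C : Type u₁) [Category.{v₁} C] [MonoidalCategory C]
    [SymmetricCategory C] (D : Type u₂) [Category.{v₂} D] [MonoidalCategory D]
    [SymmetricCategory D] : Prop :=
  ∃ (F : C ⥤ D) (_ : F.Braided), IsSymmetricMonoidalEquivalence F

/-- The underlying type of objects of `S(G, A, 0)`: an object is an element of `G`. -/
@[ext]
structure SGA (G : Type u) (A : Type v) : Type u where
  elt : G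

namespace SGA

variable {G : Type u} {A : Type v}

/-- Morphisms of `S(G, A, 0)`: there are none between different objects, and the endomorphisms of
an object are the elements of `A`. -/
@[ext]
structure Hom (a b : SGA G A) : Type v where
  eq : a.elt = b.elt
  val : A

section Groupoid

variable [AddCommGroup A]

/-- Composition is addition in `A`. -/
instance : Groupoid.{v} (SGA G A) where
  Hom := Hom
  id _ := ⟨rfl, 0⟩
  comp f g := ⟨f.eq.trans g.eq, g.val + f.val⟩
  id_comp f := Hom.ext (add_zero f.val)
  comp_id f := Hom.ext (zero_add f.val)
  assoc f g h := Hom.ext (add_assoc h.val g.val f.val).symm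
  inv f := ⟨f.eq.symm, -f.val⟩
  inv_comp f := Hom.ext (add_neg_cancel f.val)
  comp_inv f := Hom.ext (neg_add_cancel f.val)

@[ext]
theorem hom_ext {a b : SGA G A} {f g : a ⟶ b} (h : f.val = g.val) : f = g := Hom.ext h

@[simp] theorem id_val (a : SGA G A) : (𝟙 a : a ⟶ a).val = 0 := rfl

@[simp] theorem comp_val {a b c : SGA G A} (f : a ⟶ b) (g : b ⟶ c) :
    (f ≫ g).val = g.val + f.val := rfl

/-- An equality of elements of `G` gives the isomorphism with underlying element `0` of `A`. -/
def isoZero {a b : SGA G A} (h : a.elt = b.elt) : a ≅ b where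
  hom := ⟨h, 0⟩
  inv := ⟨h.symm, 0⟩
  hom_inv_id := hom_ext (add_zero 0)
  inv_hom_id := hom_ext (add_zero 0)

@[simp] theorem isoZero_hom_val {a b : SGA G A} (h : a.elt = b.elt) :
    (isoZero (A := A) h).hom.val = 0 := rfl

@[simp] theorem isoZero_inv_val {a b : SGA G A} (h : a.elt = b.elt) :
    (isoZero (A := A) h).inv.val = 0 := rfl

end Groupoid

variable [CommGroup G] [AddCommGroup A]

/-- The tensor product is multiplication in `G` on objects and addition in `A` on morphisms; the
associativity and unit constraints are all given by `0`. -/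
instance : MonoidalCategoryStruct (SGA G A) where
  tensorObj a b := ⟨a.elt * b.elt⟩
  tensorUnit := ⟨1⟩
  tensorHom f g := ⟨congrArg₂ (· * ·) f.eq g.eq, f.val + g.val⟩
  whiskerLeft a _ _ f := ⟨congrArg (a.elt * ·) f.eq, f.val⟩
  whiskerRight f b := ⟨congrArg (· * b.elt) f.eq, f.val⟩
  associator a b c := isoZero (mul_assoc a.elt b.elt c.elt)
  leftUnitor a := isoZero (one_mul a.elt)
  rightUnitor a := isoZero (mul_one a.elt)

@[simp] theorem tensorObj_elt (a b : SGA G A) : (a ⊗ b).elt = a.elt * b.elt := rfl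

@[simp] theorem tensorUnit_elt : (𝟙_ (SGA G A)).elt = 1 := rfl

@[simp] theorem tensorHom_val {a b c d : SGA G A} (f : a ⟶ b) (g : c ⟶ d) :
    (f ⊗ₘ g).val = f.val + g.val := rfl

@[simp] theorem whiskerLeft_val (a : SGA G A) {b c : SGA G A} (f : b ⟶ c) :
    (a ◁ f).val = f.val := rfl

@[simp] theorem whiskerRight_val {a b : SGA G A} (f : a ⟶ b) (c : SGA G A) :
    (f ▷ c).val = f.val := rfl

@[simp] theorem associator_hom_val (a b c : SGA G A) : (α_ a b c).hom.val = 0 := rfl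

@[simp] theorem associator_inv_val (a b c : SGA G A) : (α_ a b c).inv.val = 0 := rfl

@[simp] theorem leftUnitor_hom_val (a : SGA G A) : (λ_ a).hom.val = 0 := rfl

@[simp] theorem rightUnitor_hom_val (a : SGA G A) : (ρ_ a).hom.val = 0 := rfl

instance : MonoidalCategory (SGA G A) where
  tensorHom_def f g := by ext; simp [add_comm]
  id_tensorHom_id a b := by ext; simp
  tensorHom_comp_tensorHom f₁ f₂ g₁ g₂ := by ext; simp; abel
  whiskerLeft_id a b := by ext; simp
  id_whiskerRight a b := by ext; simp
  associator_naturality f₁ f₂ f₃ := by ext; simp [add_assoc]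
  leftUnitor_naturality f := by ext; simp
  rightUnitor_naturality f := by ext; simp
  pentagon a b c d := by ext; simp
  triangle a b := by ext; simp

/-- The symmetry constraints are all given by `0`. -/
instance : SymmetricCategory (SGA G A) where
  braiding a b := isoZero (mul_comm a.elt b.elt)
  braiding_naturality_right a _ _ f := by ext; simp
  braiding_naturality_left f c := by ext; simp
  hexagon_forward a b c := by ext; simp
  hexagon_reverse a b c := by ext; simp
  symmetry a b := by ext; simp

@[simp] theorem braiding_hom_val (a b : SGA G A) : (β_ a b).hom.val = 0 := rfl

/-- `S(G, A, 0)` is a strictly commutative Picard category. -/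
instance : IsStrictlyCommutativePicard (SGA G A) where
  all_isIso f := inferInstance
  aut_comm a f g := by ext; simp [add_comm]
  braiding_self a := by ext; simp
  exists_quasiInverse a := ⟨⟨a.elt⁻¹⟩, ⟨⟨mul_inv_cancel a.elt, 0⟩⟩⟩

end SGA

/-! For (i), let `G` be the group of isomorphism classes of `P`, `A` the automorphism group of the
unit, and `X g` a representative of the class `g`. Tensoring with an object is an equivalence, so
the scalars from `A` are exactly the automorphisms of each object (`unitScalar_bijective`). What
remains is to choose arrows `X a ⊗ X b ⟶ X (a + b)` compatible with associativity and symmetry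
(`Coherent`); a unit then comes for free (`exists_unit`).

Such a choice exists by Zorn's lemma over the subgroups of `G` (`nonempty_coherent`), once a
structure on `H` can be extended to `H + ℤg` (`exists_extension`). Over `ℤ` a multiplication is
built by recursion from arbitrary arrows "multiply by the generator"; strictness of the symmetry at
the generator makes it commutative (`exists_int`). The product family on `H × ℤ` must then descend
to `H + ℤg`. The kernel of `H × ℤ → H + ℤg` projects injectively to `ℤ`, so it is free
(`projective_ker`). Over it every object is isomorphic to the unit, and the trivializations form an
abelian extension of the kernel by `A`, which therefore splits (`exists_trivialization`). A
splitting identifies the objects in each fibre compatibly with products, which gives the descent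
(`exists_descent`).

For (ii), the categories `S(G, A, 0)` are skeletal, so an equivalence is bijective on objects and on
endomorphisms of the unit; conversely, a pair of isomorphisms acts entrywise. -/

set_option linter.unusedSectionVars false

/-! ### Cancellation of objects in a Picard category -/

section Picard

variable {P : Type u} [Category.{v} P] [MonoidalCategory P] [SymmetricCategory P]
  [IsStrictlyCommutativePicard P]

/-- Tensoring with a quasi-inverse is inverse up to isomorphism. Full faithfulness is what later
allows equations to be solved for an arrow whiskered by `x`. -/
theorem tensorRight_isEquivalence (x : P) : (tensorRight x).IsEquivalence := by
  obtain ⟨y, ⟨f⟩⟩ := IsStrictlyCommutativePicard.exists_quasiInverse x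
  let e : x ⊗ y ≅ 𝟙_ P := asIso f
  let e' : y ⊗ x ≅ 𝟙_ P := β_ y x ≪≫ e
  let E : P ≌ P := CategoryTheory.Equivalence.mk (tensorRight x) (tensorRight y)
    ((rightUnitorNatIso P).symm ≪≫ (tensoringRight P).mapIso e.symm ≪≫ tensorRightTensor x y)
    ((tensorRightTensor y x).symm ≪≫ (tensoringRight P).mapIso e' ≪≫ rightUnitorNatIso P)
  exact E.isEquivalence_functor

theorem whiskerRight_inj {a b : P} (x : P) {f g : a ⟶ b} (h : f ▷ x = g ▷ x) : f = g :=
  have := tensorRight_isEquivalence x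
  (tensorRight x).map_injective h

theorem exists_whiskerRight_eq {a b : P} (x : P) (h : a ⊗ x ⟶ b ⊗ x) : ∃ f : a ⟶ b, f ▷ x = h :=
  have := tensorRight_isEquivalence x
  (tensorRight x).map_surjective h

theorem whiskerLeft_inj {a b : P} (x : P) {f g : a ⟶ b} (h : x ◁ f = x ◁ g) : f = g := by
  apply whiskerRight_inj x
  rw [← cancel_epi (β_ x a).hom]
  simp [← BraidedCategory.braiding_naturality_right, h]

end Picard

/-! ### Coherent families of objects -/

/-- A coherent structure on a family of objects of `P` indexed by an additive commutative group `B`: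
a symmetric monoidal structure (without units) on the functor from the discrete category on `B`.
The sum of two indices is carried as a third index with a proof of equality. -/
structure Coherent {P : Type u} [Category.{v} P] [MonoidalCategory P] [SymmetricCategory P]
    {B : Type*} [AddCommGroup B] (X : B → P) where
  μ : ∀ a b c : B, a + b = c → (X a ⊗ X b ⟶ X c)
  assoc : ∀ a b c ab bc abc (hab : a + b = ab) (hbc : b + c = bc) (h : ab + c = abc)
    (h' : a + bc = abc),
    (α_ (X a) (X b) (X c)).hom ≫ X a ◁ μ b c bc hbc ≫ μ a bc abc h' =
      μ a b ab hab ▷ X c ≫ μ ab c abc h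
  comm : ∀ a b c (h : a + b = c) (h' : b + a = c),
    (β_ (X a) (X b)).hom ≫ μ b a c h' = μ a b c h

namespace Coherent

variable {P : Type u} [Category.{v} P] [MonoidalCategory P] [SymmetricCategory P]
  {B B' : Type*} [AddCommGroup B] [AddCommGroup B']

theorem assoc_assoc {X : B → P} (C : Coherent X) (a b c ab bc abc : B) (hab : a + b = ab)
    (hbc : b + c = bc) (h : ab + c = abc) (h' : a + bc = abc) {Z : P} (f : X abc ⟶ Z) :
    (α_ (X a) (X b) (X c)).hom ≫ X a ◁ C.μ b c bc hbc ≫ C.μ a bc abc h' ≫ f =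
      C.μ a b ab hab ▷ X c ≫ C.μ ab c abc h ≫ f := by
  rw [reassoc_of% C.assoc a b c ab bc abc hab hbc h h']

theorem comm_assoc {X : B → P} (C : Coherent X) (a b c : B) (h : a + b = c) (h' : b + a = c)
    {Z : P} (f : X c ⟶ Z) :
    (β_ (X a) (X b)).hom ≫ C.μ b a c h' ≫ f = C.μ a b c h ≫ f := by
  rw [reassoc_of% C.comm a b c h h']

/-- The constant family at the unit object. -/
def constUnit (B : Type*) [AddCommGroup B] (P : Type u) [Category.{v} P] [MonoidalCategory P]
    [SymmetricCategory P] : Coherent (fun _ : B => 𝟙_ P) where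
  μ _ _ _ _ := (λ_ _).hom
  assoc _ _ _ _ _ _ _ _ _ _ := by monoidal
  comm _ _ _ _ _ := by
    rw [braiding_leftUnitor, unitors_equal]

/-- Restriction of a coherent family along a homomorphism. -/
def pullback {X : B → P} (C : Coherent X) (f : B' →+ B) : Coherent (fun b => X (f b)) where
  μ a b c h := C.μ (f a) (f b) (f c) (by rw [← h, map_add])
  assoc _ _ _ _ _ _ _ _ _ _ := C.assoc _ _ _ _ _ _ _ _ _ _
  comm _ _ _ _ _ := C.comm _ _ _ _ _

variable [IsStrictlyCommutativePicard P]

/-- A family whose multiplication is related by isomorphisms to that of a coherent family indexed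
by a group surjecting onto the index group is coherent. -/
def ofSurjective {Y : B' → P} (C : Coherent Y) {X : B → P} (q : B' →+ B)
    (hq : Function.Surjective q)
    (κ : ∀ b g, q b = g → (Y b ⟶ X g))
    (μ : ∀ a b c : B, a + b = c → (X a ⊗ X b ⟶ X c))
    (hμ : ∀ a b c a' b' c' (h : a + b = c) (h' : a' + b' = c') (ha : q a = a') (hb : q b = b')
      (hc : q c = c'), (κ a a' ha ⊗ₘ κ b b' hb) ≫ μ a' b' c' h' = C.μ a b c h ≫ κ c c' hc) :
    Coherent X where
  μ := μ
  assoc a b c ab bc abc hab hbc h h' := by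
    obtain ⟨a', rfl⟩ := hq a
    obtain ⟨b', rfl⟩ := hq b
    obtain ⟨c', rfl⟩ := hq c
    have key := C.assoc a' b' c' _ _ _ rfl rfl rfl (add_assoc a' b' c').symm
    have hab' : q (a' + b') = ab := by rw [map_add, hab]
    have hbc' : q (b' + c') = bc := by rw [map_add, hbc]
    have habc' : q (a' + b' + c') = abc := by rw [map_add, hab', h]
    -- All arrows are invertible, so the identity can be tested after precomposing with `κ`, where
    -- it becomes associativity upstairs.
    rw [← cancel_epi ((κ a' _ rfl ⊗ₘ κ b' _ rfl) ⊗ₘ κ c' _ rfl)]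
    have e1 : ((κ a' _ rfl ⊗ₘ κ b' _ rfl) ⊗ₘ κ c' _ rfl) ≫ μ _ _ ab hab ▷ X (q c') ≫
        μ ab _ abc h = C.μ a' b' _ rfl ▷ Y c' ≫ C.μ _ c' _ rfl ≫ κ _ _ habc' := by
      rw [← hμ _ _ _ _ _ _ rfl h hab' rfl habc', ← tensorHom_id, tensorHom_comp_tensorHom_assoc,
        hμ _ _ _ _ _ _ rfl hab rfl rfl hab', ← tensorHom_id, tensorHom_comp_tensorHom_assoc]
      simp
    have e2 : (κ a' _ rfl ⊗ₘ (κ b' _ rfl ⊗ₘ κ c' _ rfl)) ≫ X (q a') ◁ μ _ _ bc hbc ≫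
        μ _ bc abc h' = Y a' ◁ C.μ b' c' _ rfl ≫ C.μ a' _ _ (add_assoc a' b' c').symm ≫
          κ _ _ habc' := by
      rw [← hμ _ _ _ _ _ _ _ h' rfl hbc' habc', ← id_tensorHom, tensorHom_comp_tensorHom_assoc,
        hμ _ _ _ _ _ _ rfl hbc rfl rfl hbc', ← id_tensorHom, tensorHom_comp_tensorHom_assoc]
      simp
    rw [e1, associator_naturality_assoc, e2, reassoc_of% key]
  comm a b c h h' := by
    obtain ⟨a', rfl⟩ := hq a
    obtain ⟨b', rfl⟩ := hq b
    have hc : q (a' + b') = c := by rw [map_add, h]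
    rw [← cancel_epi (κ a' _ rfl ⊗ₘ κ b' _ rfl), hμ _ _ _ _ _ _ rfl h rfl rfl hc,
      BraidedCategory.braiding_naturality_assoc,
      hμ _ _ _ _ _ _ (add_comm b' a') h' rfl rfl hc, C.comm_assoc]

/-- Transport of a coherent structure along isomorphisms of the objects. -/
noncomputable def transport {Y X : B → P} (C : Coherent Y) (θ : ∀ b, Y b ⟶ X b) : Coherent X where
  μ a b c h := inv (θ a ⊗ₘ θ b) ≫ C.μ a b c h ≫ θ c
  assoc a b c ab bc abc hab hbc h h' := by
    rw [← cancel_epi ((θ a ⊗ₘ θ b) ⊗ₘ θ c)]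
    have e1 : ((θ a ⊗ₘ θ b) ⊗ₘ θ c) ≫ (inv (θ a ⊗ₘ θ b) ≫ C.μ a b ab hab ≫ θ ab) ▷ X c =
      C.μ a b ab hab ▷ Y c ≫ (θ ab ⊗ₘ θ c) := by
      rw [← tensorHom_id, tensorHom_comp_tensorHom, ← tensorHom_id, tensorHom_comp_tensorHom]
      simp
    have e2 : (θ a ⊗ₘ (θ b ⊗ₘ θ c)) ≫ X a ◁ (inv (θ b ⊗ₘ θ c) ≫ C.μ b c bc hbc ≫ θ bc) =
      Y a ◁ C.μ b c bc hbc ≫ (θ a ⊗ₘ θ bc) := by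
      rw [← id_tensorHom, tensorHom_comp_tensorHom, ← id_tensorHom, tensorHom_comp_tensorHom]
      simp
    rw [reassoc_of% e1, associator_naturality_assoc, reassoc_of% e2]
    simp only [IsIso.hom_inv_id_assoc]
    exact C.assoc_assoc _ _ _ _ _ _ _ _ _ _ _
  comm a b c h h' := by
    rw [← cancel_epi (θ a ⊗ₘ θ b), BraidedCategory.braiding_naturality_assoc]
    simp only [IsIso.hom_inv_id_assoc]
    exact C.comm_assoc _ _ _ _ _ _

theorem tensorHom_transport_μ {Y X : B → P} (C : Coherent Y) (θ : ∀ b, Y b ⟶ X b) (a b c : B)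
    (h : a + b = c) : (θ a ⊗ₘ θ b) ≫ (C.transport θ).μ a b c h = C.μ a b c h ≫ θ c := by
  simp [transport]

/-- The case `a = 0` defines `ε`, by fullness of tensoring with `X 0`. Associativity at `(0, 0, a)`,
with one factor `C.μ 0 a a` cancelled, carries it to every `a`. -/
theorem exists_unit {X : B → P} (C : Coherent X) :
    ∃ ε : 𝟙_ P ⟶ X 0, ∀ a, ε ▷ X a ≫ C.μ 0 a a (zero_add a) = (λ_ (X a)).hom := by
  obtain ⟨ε, hε⟩ := exists_whiskerRight_eq (X 0)
    ((λ_ (X 0)).hom ≫ inv (C.μ 0 0 0 (zero_add 0)))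
  refine ⟨ε, fun a => ?_⟩
  have h1 := C.assoc 0 0 a 0 a a (zero_add 0) (zero_add a) (zero_add a) (zero_add a)
  have h2 : (α_ (X 0) (X 0) (X a)).hom ≫ X 0 ◁ C.μ 0 a a (zero_add a) =
      C.μ 0 0 0 (zero_add 0) ▷ X a := by
    rw [← cancel_mono (C.μ 0 a a (zero_add a)), Category.assoc, h1]
  have h3 : (ε ▷ X 0) ▷ X a ≫ C.μ 0 0 0 (zero_add 0) ▷ X a = (λ_ (X 0)).hom ▷ X a := by
    rw [← comp_whiskerRight, hε]; simp
  rw [← h2, associator_naturality_left_assoc, ← whisker_exchange] at h3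
  rw [← cancel_epi (𝟙_ P ◁ C.μ 0 a a (zero_add a)),
    ← cancel_epi (α_ (𝟙_ P) (X 0) (X a)).hom, reassoc_of% h3]
  simp

theorem unit_right {X : B → P} (C : Coherent X) {ε : 𝟙_ P ⟶ X 0}
    (hε : ∀ a, ε ▷ X a ≫ C.μ 0 a a (zero_add a) = (λ_ (X a)).hom) (a : B) :
    X a ◁ ε ≫ C.μ a 0 a (add_zero a) = (ρ_ (X a)).hom := by
  rw [← C.comm a 0 a (add_zero a) (zero_add a), BraidedCategory.braiding_naturality_right_assoc, hε]
  simp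

end Coherent

/-! ### Products of families, recursion over `ℤ`, commuting indices -/

theorem tensorμ_braiding {C : Type u} [Category.{v} C] [MonoidalCategory C] [SymmetricCategory C]
    (a b c d : C) : (β_ (a ⊗ b) (c ⊗ d)).hom ≫ tensorμ c d a b =
      tensorμ a b c d ≫ ((β_ a c).hom ⊗ₘ (β_ b d).hom) := by
  dsimp only [tensorμ]
  rw [BraidedCategory.braiding_tensor_left_hom, BraidedCategory.braiding_tensor_right_hom,
    BraidedCategory.braiding_tensor_right_hom]
  calc
    _ = 𝟙 _ ⊗≫ a ◁ (β_ b c).hom ▷ d ⊗≫ ((a ⊗ c) ◁ (β_ b d).hom ≫ (β_ a c).hom ▷ (d ⊗ b)) ⊗≫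
        c ◁ ((β_ a d).hom ≫ (β_ d a).hom) ▷ b ⊗≫ 𝟙 _ := by monoidal
    -- The crossing of `a` with `d` is made and then undone; it cancels because the braiding is a
    -- symmetry.
    _ = _ := by
      rw [SymmetricCategory.symmetry, whisker_exchange, MonoidalCategory.tensorHom_def]
      monoidal

/-- Two-sided recursion over the integers along a family of bijections. -/
theorem Int.exists_forall_succ_eq {T : ℤ → Type*} (x : T 0) (e : ∀ n, T n ≃ T (n + 1)) :
    ∃ f : ∀ n, T n, f 0 = x ∧ ∀ n, f (n + 1) = e n (f n) := by
  let pr : ∀ n : ℤ, n ≤ 0 → T n → T (n - 1) := fun n _ y =>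
    (e (n - 1)).symm (cast (congrArg T (sub_add_cancel n 1).symm) y)
  refine ⟨fun n => Int.inductionOn' n 0 x (fun n _ y => e n y) pr, Int.inductionOn'_self, ?_⟩
  intro n
  rcases le_or_gt 0 n with hn | hn
  · exact Int.inductionOn'_add_one hn
  -- The downward recursion passes from `n + 1` to `n + 1 - 1`, which is only propositionally `n`;
  -- free indices `m`, `k` let the cast be eliminated.
  · have key : ∀ m k (hm : m = n + 1) (hk : k = m - 1), ∀ (z : ∀ n, T n),
        z (m - 1) = (e (m - 1)).symm (cast (congrArg T (sub_add_cancel m 1).symm) (z m)) →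
        z (k + 1) = e k (z k) := by
      rintro m k hm rfl z hz
      rw [hz, Equiv.apply_symm_apply, eq_cast_iff_heq, sub_add_cancel]
    exact key (n + 1) n rfl (by ring)
      (fun n => Int.inductionOn' n 0 x (fun n _ y => e n y) pr)
      (Int.inductionOn'_sub_one (b := 0) (z := n + 1) hn)

namespace Coherent

variable {P : Type u} [Category.{v} P] [MonoidalCategory P] [SymmetricCategory P]
  {B B' : Type*} [AddCommGroup B] [AddCommGroup B']

/-- The tensor product of two coherent families. -/
def prod {X : B → P} (C : Coherent X) {Y : B' → P} (D : Coherent Y) :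
    Coherent (fun b : B × B' => X b.1 ⊗ Y b.2) where
  μ a b c h := tensorμ _ _ _ _ ≫ (C.μ a.1 b.1 c.1 (congrArg Prod.fst h) ⊗ₘ
    D.μ a.2 b.2 c.2 (congrArg Prod.snd h))
  assoc a b c ab bc abc hab hbc h h' := by
    simp only [MonoidalCategory.whiskerLeft_comp, comp_whiskerRight, Category.assoc]
    rw [tensorμ_natural_left_assoc, tensorμ_natural_right_assoc, ← tensor_associativity_assoc,
      tensorHom_comp_tensorHom, tensorHom_comp_tensorHom, tensorHom_comp_tensorHom]
    rw [C.assoc _ _ _ _ _ _ (congrArg Prod.fst hab) _ (congrArg Prod.fst h) _,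
      D.assoc _ _ _ _ _ _ (congrArg Prod.snd hab) _ (congrArg Prod.snd h) _]
  comm a b c h h' := by
    rw [← Category.assoc, tensorμ_braiding, Category.assoc, tensorHom_comp_tensorHom,
      C.comm _ _ _ (congrArg Prod.fst h), D.comm _ _ _ (congrArg Prod.snd h)]

section comm

variable {X : B → P} (μ : ∀ a b c : B, a + b = c → (X a ⊗ X b ⟶ X c))

/-- Two indices commute with respect to a multiplication on a family of objects. -/
def Commutes (a b : B) : Prop :=
  ∀ c (h : a + b = c) (h' : b + a = c), (β_ (X a) (X b)).hom ≫ μ b a c h' = μ a b c h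

theorem Commutes.symm {μ : ∀ a b c : B, a + b = c → (X a ⊗ X b ⟶ X c)} {a b : B}
    (H : Commutes μ a b) : Commutes μ b a := by
  intro c h h'
  rw [← H c h' h, SymmetricCategory.symmetry_assoc]

/-- By the hexagon and associativity, moving `a` past `b + c` is moving it past `b` and then past
`c`. The first move is known, and the second can be isolated since whiskering is faithful. -/
theorem Commutes.add_iff [IsStrictlyCommutativePicard P]
    {μ : ∀ a b c : B, a + b = c → (X a ⊗ X b ⟶ X c)}
    (assoc : ∀ a b c ab bc abc (hab : a + b = ab) (hbc : b + c = bc) (h : ab + c = abc)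
      (h' : a + bc = abc),
      (α_ (X a) (X b) (X c)).hom ≫ X a ◁ μ b c bc hbc ≫ μ a bc abc h' =
        μ a b ab hab ▷ X c ≫ μ ab c abc h)
    {a b c : B} (hb : Commutes μ a b) : Commutes μ a (b + c) ↔ Commutes μ a c := by
  have key : (β_ (X a) (X (b + c))).hom ≫ μ (b + c) a _ (add_comm (b + c) a) =
      μ a (b + c) _ rfl ↔ (β_ (X a) (X c)).hom ≫ μ c a _ (add_comm c a) = μ a c _ rfl := by
    rw [← cancel_epi (X a ◁ μ b c _ rfl), BraidedCategory.braiding_naturality_right_assoc,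
      ← cancel_epi (α_ _ _ _).hom, assoc a b c _ _ _ rfl rfl (add_assoc a b c) rfl,
      ← assoc b c a _ _ _ rfl (add_comm c a) _ (by abel), ← hb _ rfl (add_comm b a)]
    have h1 := BraidedCategory.hexagon_forward (X a) (X b) (X c)
    rw [reassoc_of% h1]
    have h2 := assoc b a c _ _ _ (add_comm b a) rfl (add_assoc a b c) (by abel)
    rw [comp_whiskerRight_assoc, ← h2, cancel_epi, cancel_epi, ← Category.assoc,
      ← MonoidalCategory.whiskerLeft_comp, cancel_mono]
    exact ⟨whiskerLeft_inj _, fun h => by rw [h]⟩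
  constructor
  · rintro H _ rfl h'
    exact key.1 (H _ _ _)
  · rintro H _ rfl h'
    exact key.2 (H _ _ _)

end comm

end Coherent

/-! ### Families indexed by `ℤ` -/

namespace Coherent

variable {P : Type u} [Category.{v} P] [MonoidalCategory P] [SymmetricCategory P]
  [IsStrictlyCommutativePicard P]

/-- For fixed `a`, associativity at `(a, b, 1)`, with `s` as multiplication by the generator,
determines the product at `(a, b + 1)` from that at `(a, b)` and conversely, because tensoring with
`X 1` is fully faithful. The value at `b = 0` is prescribed by `ε`. -/
theorem exists_int_mul {X : ℤ → P} (ε : 𝟙_ P ⟶ X 0) (s : ∀ n m : ℤ, n + 1 = m → (X n ⊗ X 1 ⟶ X m)) :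
    ∃ μ : ∀ a b c : ℤ, a + b = c → (X a ⊗ X b ⟶ X c),
      (∀ a, X a ◁ ε ≫ μ a 0 a (add_zero a) = (ρ_ (X a)).hom) ∧
      ∀ a b c b' c' (h : a + b = c) (hb : b + 1 = b') (hc : c + 1 = c') (h' : a + b' = c'),
        (α_ (X a) (X b) (X 1)).hom ≫ X a ◁ s b b' hb ≫ μ a b' c' h' =
          μ a b c h ▷ X 1 ≫ s c c' hc := by
  have key : ∀ a : ℤ, ∃ f : ∀ b : ℤ, X a ⊗ X b ⟶ X (a + b),
      f 0 = inv (X a ◁ ε) ≫ (ρ_ (X a)).hom ≫ eqToHom (congrArg X (add_zero a).symm) ∧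
      ∀ b, f (b + 1) = inv ((α_ (X a) (X b) (X 1)).hom ≫ X a ◁ s b (b + 1) rfl) ≫
        f b ▷ X 1 ≫ s (a + b) (a + (b + 1)) (add_assoc a b 1) := by
    intro a
    refine Int.exists_forall_succ_eq (T := fun b => (X a ⊗ X b ⟶ X (a + b))) _
      (fun b => Equiv.ofBijective (fun f =>
        inv ((α_ (X a) (X b) (X 1)).hom ≫ X a ◁ s b (b + 1) rfl) ≫
        f ▷ X 1 ≫ s (a + b) (a + (b + 1)) (add_assoc a b 1)) ⟨?_, ?_⟩)
    · intro f g hfg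
      rw [cancel_epi, cancel_mono] at hfg
      exact whiskerRight_inj _ hfg
    · intro g
      obtain ⟨f, hf⟩ := exists_whiskerRight_eq (X 1)
        (((α_ (X a) (X b) (X 1)).hom ≫ X a ◁ s b (b + 1) rfl) ≫ g ≫
          inv (s (a + b) (a + (b + 1)) (add_assoc a b 1)))
      exact ⟨f, by simp [hf]⟩
  choose f hf0 hf1 using key
  refine ⟨fun a b c h => f a b ≫ eqToHom (congrArg X h), fun a => ?_, ?_⟩
  · simp [hf0]
  · rintro a b _ _ _ rfl rfl hc rfl
    simp [hf1]

/-- Associativity follows by two-sided induction on the last index. Commutativity propagates from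
the pair `(1, 1)` by `Commutes.add_iff`, and there it is the strictness of the symmetry. -/
theorem exists_int {X : ℤ → P} (ε : 𝟙_ P ⟶ X 0)
    (s : ∀ n m : ℤ, n + 1 = m → (X n ⊗ X 1 ⟶ X m)) : Nonempty (Coherent X) := by
  obtain ⟨μ, h0, h1⟩ := exists_int_mul ε s
  have assoc : ∀ a b c ab bc abc (hab : a + b = ab) (hbc : b + c = bc) (h : ab + c = abc)
    (h' : a + bc = abc),
    (α_ (X a) (X b) (X c)).hom ≫ X a ◁ μ b c bc hbc ≫ μ a bc abc h' =
      μ a b ab hab ▷ X c ≫ μ ab c abc h := by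
    intro a b c ab bc abc hab hbc h h'
    -- Associativity at `c + 1` is associativity at `c` whiskered by `X 1`, up to invertible arrows;
    -- the equivalence serves both directions of the induction.
    have step : ∀ c bc abc c' bc' abc' (hbc : b + c = bc) (h : ab + c = abc)
        (h' : a + bc = abc) (hc : c + 1 = c') (hbc' : b + c' = bc') (hh : ab + c' = abc')
        (hh' : a + bc' = abc'),
        ((α_ (X a) (X b) (X c)).hom ≫ X a ◁ μ b c bc hbc ≫ μ a bc abc h' =
          μ a b ab hab ▷ X c ≫ μ ab c abc h) ↔
        ((α_ (X a) (X b) (X c')).hom ≫ X a ◁ μ b c' bc' hbc' ≫ μ a bc' abc' hh' =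
          μ a b ab hab ▷ X c' ≫ μ ab c' abc' hh) := by
      intro c bc abc c' bc' abc' hbc h h' hc hbc' hh hh'
      have e1 := h1 b c bc c' bc' hbc hc (by lia) hbc'
      have e2 := h1 a bc abc bc' abc' h' (by lia) (by lia) hh'
      have e3 := h1 ab c abc c' abc' h hc (by lia) hh
      rw [← cancel_epi ((α_ (X a ⊗ X b) (X c) (X 1)).hom ≫ (X a ⊗ X b) ◁ s c c' hc)]
      have l : ((α_ (X a ⊗ X b) (X c) (X 1)).hom ≫ (X a ⊗ X b) ◁ s c c' hc) ≫
          (α_ (X a) (X b) (X c')).hom ≫ X a ◁ μ b c' bc' hbc' ≫ μ a bc' abc' hh' =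
          ((α_ (X a) (X b) (X c)).hom ≫ X a ◁ μ b c bc hbc ≫ μ a bc abc h') ▷ X 1 ≫
            s abc abc' (by lia) := by
        rw [comp_whiskerRight_assoc, comp_whiskerRight_assoc, ← e2]
        have e1' : X a ◁ (α_ (X b) (X c) (X 1)).hom ≫ X a ◁ X b ◁ s c c' hc ≫
            X a ◁ μ b c' bc' hbc' = X a ◁ μ b c bc hbc ▷ X 1 ≫ X a ◁ s bc bc' (by lia) := by
          rw [← MonoidalCategory.whiskerLeft_comp, ← MonoidalCategory.whiskerLeft_comp, e1]
          simp
        rw [associator_naturality_middle_assoc, ← reassoc_of% e1']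
        simp
      have r : ((α_ (X a ⊗ X b) (X c) (X 1)).hom ≫ (X a ⊗ X b) ◁ s c c' hc) ≫
          μ a b ab hab ▷ X c' ≫ μ ab c' abc' hh =
          (μ a b ab hab ▷ X c ≫ μ ab c abc h) ▷ X 1 ≫ s abc abc' (by lia) := by
        rw [comp_whiskerRight_assoc, ← e3, Category.assoc, whisker_exchange_assoc]
        simp
      rw [l, r, cancel_mono]
      exact ⟨fun h => by rw [h], whiskerRight_inj _⟩
    induction c using Int.induction_on generalizing bc abc with
    | zero =>
      obtain rfl : b = bc := by lia
      obtain rfl : ab = abc := by lia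
      obtain rfl : a + b = ab := hab
      rw [← cancel_epi ((X a ⊗ X b) ◁ ε), whisker_exchange_assoc, h0,
        associator_naturality_right_assoc, ← MonoidalCategory.whiskerLeft_comp_assoc, h0]
      simp
    | succ n ih => exact (step n _ _ _ _ _ rfl rfl (by lia) rfl hbc h h').1 (ih _ _ _ _ _)
    | pred n ih => exact (step _ _ _ (-n) _ _ hbc h h' (by lia) rfl rfl (by lia)).2 (ih _ _ _ _ _)
  have comm_of_one : ∀ a, Commutes μ a 1 → ∀ b, Commutes μ a b := by
    intro a ha b
    induction b using Int.induction_on with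
    -- Since `1 + 0` reduces to `1`, the hypothesis `ha` also serves as the statement for the sum.
    | zero => exact (Commutes.add_iff assoc ha (c := 0)).1 ha
    | succ n ih => exact (Commutes.add_iff assoc ih).2 ha
    | pred n ih =>
      refine (Commutes.add_iff assoc ha).1 ?_
      rwa [add_sub_cancel]
  have comm_one : Commutes μ 1 1 := fun c h h' => by
    rw [IsStrictlySymmetricAbelianGroupoid.braiding_self, Category.id_comp]
  exact ⟨⟨μ, assoc, fun a b => comm_of_one a (comm_of_one 1 comm_one a).symm b⟩⟩

end Coherent

/-! ### Splitting the extension attached to a family of trivial objects -/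

namespace Coherent

variable {P : Type u} [Category.{v} P] [MonoidalCategory P] [SymmetricCategory P]

section Trivialization

variable {K : Type*} [AddCommGroup K] {Y : K → P}

/-- Elements of the extension of `K` by the automorphisms of the unit object that is attached to a
coherent family on `K`: an index together with a trivialization of the object at that index. -/
structure Trivialization (C : Coherent Y) where
  idx : K
  arrow : 𝟙_ P ⟶ Y idx

namespace Trivialization

variable {C : Coherent Y}

instance : Add (Trivialization C) where
  add s t := ⟨s.idx + t.idx, (λ_ _).inv ≫ (s.arrow ⊗ₘ t.arrow) ≫ C.μ _ _ _ rfl⟩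

theorem mk_add_mk {k l m : K} (u : 𝟙_ P ⟶ Y k) (v : 𝟙_ P ⟶ Y l) (h : k + l = m) :
    (⟨k, u⟩ + ⟨l, v⟩ : Trivialization C) = ⟨m, (λ_ _).inv ≫ (u ⊗ₘ v) ≫ C.μ k l m h⟩ := by
  subst h; rfl

protected theorem add_comm (s t : Trivialization C) : s + t = t + s := by
  obtain ⟨k, u⟩ := s
  obtain ⟨l, v⟩ := t
  rw [mk_add_mk u v rfl, mk_add_mk v u (add_comm l k), ← C.comm k l _ rfl (add_comm l k),
    BraidedCategory.braiding_naturality_assoc]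
  -- The symmetry of the unit with itself is trivial, so the extension is commutative.
  have : (λ_ (𝟙_ P)).inv ≫ (β_ (𝟙_ P) (𝟙_ P)).hom = (λ_ (𝟙_ P)).inv := by
    rw [leftUnitor_inv_braiding, unitors_inv_equal]
  rw [reassoc_of% this]

protected theorem add_assoc (r s t : Trivialization C) : r + s + t = r + (s + t) := by
  obtain ⟨k, u⟩ := r
  obtain ⟨l, v⟩ := s
  obtain ⟨m, w⟩ := t
  rw [mk_add_mk u v rfl, mk_add_mk _ w rfl, mk_add_mk v w rfl,
    mk_add_mk u _ (add_assoc k l m).symm]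
  have h := C.assoc k l m _ _ _ rfl rfl rfl (add_assoc k l m).symm
  congr 2
  have e1 : (((λ_ (𝟙_ P)).inv ≫ (u ⊗ₘ v) ≫ C.μ k l (k + l) rfl) ⊗ₘ w) =
      (λ_ _).inv ▷ _ ≫ ((u ⊗ₘ v) ⊗ₘ w) ≫ C.μ k l (k + l) rfl ▷ Y m := by
    rw [← tensorHom_id, ← tensorHom_id, tensorHom_comp_tensorHom, tensorHom_comp_tensorHom]
    simp
  have e2 : (u ⊗ₘ ((λ_ (𝟙_ P)).inv ≫ (v ⊗ₘ w) ≫ C.μ l m (l + m) rfl)) =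
      _ ◁ (λ_ _).inv ≫ (u ⊗ₘ (v ⊗ₘ w)) ≫ Y k ◁ C.μ l m (l + m) rfl := by
    rw [← id_tensorHom, ← id_tensorHom, tensorHom_comp_tensorHom, tensorHom_comp_tensorHom]
    simp
  rw [e1, e2]
  simp only [Category.assoc]
  rw [← h, associator_naturality_assoc]
  simp only [← Category.assoc]
  congr 3
  monoidal

variable [IsStrictlyCommutativePicard P]

noncomputable instance : Zero (Trivialization C) where
  zero := ⟨0, C.exists_unit.choose⟩

protected theorem zero_add (s : Trivialization C) : 0 + s = s := by
  obtain ⟨k, u⟩ := s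
  change (⟨0, _⟩ + ⟨k, u⟩ : Trivialization C) = _
  rw [mk_add_mk _ u (zero_add k), tensorHom_def', Category.assoc, C.exists_unit.choose_spec]
  simp

theorem exists_neg (s : Trivialization C) : ∃ t : Trivialization C, t + s = 0 := by
  obtain ⟨k, u⟩ := s
  obtain ⟨w, hw⟩ := exists_whiskerRight_eq (Y k) (inv ((λ_ (𝟙_ P)).inv ≫ 𝟙_ P ◁ u) ≫
    C.exists_unit.choose ≫ inv (C.μ (-k) k 0 (neg_add_cancel k)))
  refine ⟨⟨-k, w⟩, ?_⟩
  rw [mk_add_mk w u (neg_add_cancel k), tensorHom_def', hw]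
  simp only [IsIso.inv_comp, Category.assoc, IsIso.inv_hom_id, IsIso.hom_inv_id_assoc,
    Category.comp_id]
  rfl

noncomputable instance : Neg (Trivialization C) where
  neg s := (exists_neg s).choose

noncomputable instance : AddCommGroup (Trivialization C) :=
  { AddGroup.ofLeftAxioms Trivialization.add_assoc Trivialization.zero_add
      fun s => (exists_neg s).choose_spec with
    add_comm := Trivialization.add_comm }

/-- The projection of the extension onto the group of indices. -/
noncomputable def idxHom (C : Coherent Y) : Trivialization C →+ K :=
  AddMonoidHom.mk' idx fun _ _ => rfl

end Trivialization

/-- A coherent family of trivial objects indexed by a projective abelian group is trivial. -/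
theorem exists_trivialization [IsStrictlyCommutativePicard P] [Module.Projective ℤ K]
    (C : Coherent Y) (hY : ∀ k, Nonempty (𝟙_ P ⟶ Y k)) :
    ∃ u : ∀ k, 𝟙_ P ⟶ Y k, ∀ a b c (h : a + b = c),
      (u a ⊗ₘ u b) ≫ C.μ a b c h = (λ_ _).hom ≫ u c := by
  -- Additivity of the section `σ` is precisely the multiplicativity required of the
  -- trivializations.
  obtain ⟨σ, hσ⟩ := Module.projective_lifting_property
    (Trivialization.idxHom C).toIntLinearMap (LinearMap.id (R := ℤ) (M := K))
    (fun k => ⟨⟨k, (hY k).some⟩, rfl⟩)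
  have hu : ∀ k, ∃ u : 𝟙_ P ⟶ Y k, σ k = ⟨k, u⟩ := fun k => by
    have h1 : (σ k).idx = k := LinearMap.congr_fun hσ k
    generalize σ k = s at h1
    obtain ⟨l, u⟩ := s
    obtain rfl : l = k := h1
    exact ⟨u, rfl⟩
  choose u hu using hu
  refine ⟨u, ?_⟩
  rintro a b c h
  have h1 : σ c = σ a + σ b := by rw [← map_add, h]
  rw [hu, hu, hu, Trivialization.mk_add_mk _ _ h] at h1
  have h2 : u c = (λ_ _).inv ≫ (u a ⊗ₘ u b) ≫ C.μ a b c h := by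
    simpa using h1
  rw [h2, Iso.hom_inv_id_assoc]

end Trivialization

/-! ### Descent along a surjection -/

section Descent

variable {B B' : Type*} [AddCommGroup B] [AddCommGroup B'] {Y : B → P} (C : Coherent Y)

/-- Translation by an index whose object is trivialized. -/
def translate {k : B} (u : 𝟙_ P ⟶ Y k) (a a' : B) (h : a + k = a') : Y a ⟶ Y a' :=
  (ρ_ _).inv ≫ Y a ◁ u ≫ C.μ a k a' h

/-- This is associativity at `(a, b, k)`, precomposed with `u` in the last slot. -/
theorem whiskerLeft_translate {k : B} (u : 𝟙_ P ⟶ Y k) (a b b' c c' : B) (hb : b + k = b')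
    (hc : c + k = c') (h : a + b = c) (h' : a + b' = c') :
    Y a ◁ C.translate u b b' hb ≫ C.μ a b' c' h' = C.μ a b c h ≫ C.translate u c c' hc := by
  have h1 := C.assoc a b k c b' c' h hb hc h'
  simp only [translate, MonoidalCategory.whiskerLeft_comp, Category.assoc]
  rw [rightUnitor_inv_naturality_assoc, ← whisker_exchange_assoc, ← h1]
  simp

theorem translate_whiskerRight {k : B} (u : 𝟙_ P ⟶ Y k) (a a' b c c' : B) (ha : a + k = a')
    (hc : c + k = c') (h : a + b = c) (h' : a' + b = c') :
    C.translate u a a' ha ▷ Y b ≫ C.μ a' b c' h' = C.μ a b c h ≫ C.translate u c c' hc := by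
  have hbc : b + a = c := by rw [add_comm, h]
  have hbc' : b + a' = c' := by rw [add_comm, h']
  rw [← C.comm _ _ _ h' hbc', BraidedCategory.braiding_naturality_left_assoc,
    whiskerLeft_translate C u b a a' c c' ha hc hbc hbc', C.comm_assoc _ _ _ h hbc]

theorem translate_comp {k l m : B} (u : 𝟙_ P ⟶ Y k) (v : 𝟙_ P ⟶ Y l) (w : 𝟙_ P ⟶ Y m)
    (hm : k + l = m) (hw : (u ⊗ₘ v) ≫ C.μ k l m hm = (λ_ _).hom ≫ w) (a a' a'' : B)
    (h : a + k = a') (h' : a' + l = a'') (h'' : a + m = a'') :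
    C.translate u a a' h ≫ C.translate v a' a'' h' = C.translate w a a'' h'' := by
  have h1 : u ≫ C.translate v k m hm = w := by
    rw [← cancel_epi (λ_ (𝟙_ P)).hom, ← hw, translate, rightUnitor_inv_naturality_assoc,
      MonoidalCategory.tensorHom_def, unitors_equal]
    simp
  have h2 : C.translate u a a' h ≫ C.translate v a' a'' h' =
      (ρ_ _).inv ≫ Y a ◁ u ≫ C.μ a k a' h ≫ C.translate v a' a'' h' := by
    simp [translate]
  rw [h2, ← whiskerLeft_translate C v a k m a' a'' hm h' h h'',
    ← MonoidalCategory.whiskerLeft_comp_assoc, h1, translate]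

/-- A coherent family descends along a surjective homomorphism on whose kernel it is trivialized. -/
theorem exists_descent [IsStrictlyCommutativePicard P] (q : B →+ B') (hq : Function.Surjective q)
    (u : ∀ k, q k = 0 → (𝟙_ P ⟶ Y k))
    (hu : ∀ a b c (ha : q a = 0) (hb : q b = 0) (hc : q c = 0) (h : a + b = c),
      (u a ha ⊗ₘ u b hb) ≫ C.μ a b c h = (λ_ _).hom ≫ u c hc)
    {X : B' → P} (hX : ∀ b, Nonempty (Y b ⟶ X (q b))) :
    ∃ (D : Coherent X) (κ : ∀ b g, q b = g → (Y b ⟶ X g)),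
      ∀ a b c a' b' c' (h : a + b = c) (h' : a' + b' = c') (ha : q a = a') (hb : q b = b')
        (hc : q c = c'), (κ a a' ha ⊗ₘ κ b b' hb) ≫ D.μ a' b' c' h' = C.μ a b c h ≫ κ c c' hc := by
  -- A set-theoretic section suffices: `τ` below identifies all objects in one fibre, canonically
  -- and compatibly with products.
  choose s hs using hq
  let θ : ∀ g, Y (s g) ⟶ X g := fun g => (hX (s g)).some ≫ eqToHom (congrArg X (hs g))
  have hk : ∀ {b b'}, q b = q b' → q (b' - b) = 0 := fun h => by rw [map_sub, h, sub_self]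
  let τ : ∀ b b', q b = q b' → (Y b ⟶ Y b') := fun b b' h =>
    C.translate (u (b' - b) (hk h)) b b' (add_sub_cancel b b')
  have τ_comp : ∀ a b c h h' h'', τ a b h ≫ τ b c h' = τ a c h'' := fun a b c h h' h'' =>
    C.translate_comp _ _ _ (by abel) (hu _ _ _ _ _ _ _) _ _ _ _ _ _
  have τ_mul : ∀ a b c a' b' c' (h : a + b = c) (h' : a' + b' = c') ha hb hc,
      (τ a a' ha ⊗ₘ τ b b' hb) ≫ C.μ a' b' c' h' = C.μ a b c h ≫ τ c c' hc := by
    intro a b c a' b' c' h h' ha hb hc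
    have h1 : a' + b = a' + b := rfl
    rw [MonoidalCategory.tensorHom_def, Category.assoc,
      whiskerLeft_translate C _ a' b b' (a' + b) c' _ (by rw [← h']; abel) rfl,
      ← Category.assoc, translate_whiskerRight C _ a a' b c (a' + b) _ (by rw [← h]; abel) h,
      Category.assoc]
    congr 1
    exact C.translate_comp _ _ _ (by rw [← h, ← h']; abel) (hu _ _ _ _ _ _ _) _ _ _ _ _ _
  -- Translate to the chosen point of the fibre, then apply the arbitrary isomorphism `θ` there.
  let κ : ∀ b g, q b = g → (Y b ⟶ X g) := fun b g h => τ b (s g) (h.trans (hs g).symm) ≫ θ g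
  let μ : ∀ a b c : B', a + b = c → (X a ⊗ X b ⟶ X c) := fun a b c h =>
    inv (θ a ⊗ₘ θ b) ≫ C.μ (s a) (s b) _ rfl ≫ κ (s a + s b) c (by rw [map_add, hs, hs, h])
  have hμ : ∀ a b c a' b' c' (h : a + b = c) (h' : a' + b' = c') (ha : q a = a') (hb : q b = b')
        (hc : q c = c'), (κ a a' ha ⊗ₘ κ b b' hb) ≫ μ a' b' c' h' = C.μ a b c h ≫ κ c c' hc := by
    intro a b c a' b' c' h h' ha hb hc
    have ha' : q a = q (s a') := by rw [hs, ha]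
    have hb' : q b = q (s b') := by rw [hs, hb]
    have hc' : q c = q (s a' + s b') := by rw [map_add, hs, hs, hc, h']
    have hs' : q (s a' + s b') = q (s c') := by rw [← hc', hc, hs]
    simp only [κ, μ]
    rw [← tensorHom_comp_tensorHom, Category.assoc, IsIso.hom_inv_id_assoc, ← Category.assoc,
      τ_mul a b c (s a') (s b') _ h rfl ha' hb' hc', Category.assoc,
      ← Category.assoc (τ _ _ hc'), τ_comp _ _ _ hc' hs' (hc'.trans hs')]
  exact ⟨C.ofSurjective q (fun g => ⟨s g, hs g⟩) κ μ hμ, κ, hμ⟩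

end Descent

end Coherent

/-! ### Adjoining one element to a subgroup -/

theorem rightUnitor_inv_tensorHom_tensorμ {C : Type u} [Category.{v} C] [MonoidalCategory C]
    [BraidedCategory C] (a b : C) :
    ((ρ_ a).inv ⊗ₘ (ρ_ b).inv) ≫ tensorμ a (𝟙_ C) b (𝟙_ C) ≫ (a ⊗ b) ◁ (λ_ (𝟙_ C)).hom =
      (ρ_ (a ⊗ b)).inv := by
  dsimp only [tensorμ]
  rw [braiding_tensorUnit_left]
  monoidal

namespace Coherent

variable {P : Type u} [Category.{v} P] [MonoidalCategory P] [SymmetricCategory P]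

/-- The embedding of the first factor respects multiplication because `ε` is idempotent for `D`. It
is needed to compare the extended structure with the original one. -/
theorem tensorHom_unit_prod_μ {B B' : Type*} [AddCommGroup B] [AddCommGroup B']
    {X : B → P} (C : Coherent X) {Y : B' → P} (D : Coherent Y) {ε : 𝟙_ P ⟶ Y 0}
    (hε : ∀ a, ε ▷ Y a ≫ D.μ 0 a a (zero_add a) = (λ_ (Y a)).hom) (a b c : B) (h : a + b = c)
    (h' : (a, (0 : B')) + (b, 0) = (c, 0)) :
    (((ρ_ (X a)).inv ≫ X a ◁ ε) ⊗ₘ ((ρ_ (X b)).inv ≫ X b ◁ ε)) ≫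
      (C.prod D).μ (a, 0) (b, 0) (c, 0) h' = C.μ a b c h ≫ (ρ_ (X c)).inv ≫ X c ◁ ε := by
  have h1 : (ε ⊗ₘ ε) ≫ D.μ 0 0 0 (zero_add 0) = (λ_ _).hom ≫ ε := by
    rw [tensorHom_def', Category.assoc, hε, leftUnitor_naturality]
  have h2 := tensorμ_natural (𝟙 (X a)) ε (𝟙 (X b)) ε
  simp only [prod]
  rw [← tensorHom_comp_tensorHom, Category.assoc, ← id_tensorHom, ← id_tensorHom,
    reassoc_of% h2, tensorHom_comp_tensorHom]
  rw [h1, id_tensorHom_id, Category.id_comp, rightUnitor_inv_naturality_assoc,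
    ← rightUnitor_inv_tensorHom_tensorμ]
  simp [← tensorHom_id, ← id_tensorHom]

/-- A kernel element `(h, n)` is determined by `n` since `i` is injective, so the kernel is
isomorphic to a subgroup of `ℤ`. -/
theorem projective_ker {H G : Type*} [AddCommGroup H] [AddCommGroup G] (i : H →+ G)
    (hi : Function.Injective i) (g : G) :
    Module.Projective ℤ (i.coprod (zmultiplesHom G g)).ker := by
  let f : (i.coprod (zmultiplesHom G g)).ker →ₗ[ℤ] ℤ :=
    ((AddMonoidHom.snd H ℤ).comp (AddSubgroup.subtype _)).toIntLinearMap
  have hf : Function.Injective f := by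
    rw [injective_iff_map_eq_zero]
    rintro ⟨⟨h, n⟩, hk⟩ (hn : n = 0)
    subst hn
    have : i h = 0 := by simpa using hk
    have : h = 0 := hi (by rw [this, map_zero])
    subst this
    rfl
  have : Module.Free ℤ (LinearMap.range f) := inferInstance
  exact Module.Projective.of_equiv (LinearEquiv.ofInjective f hf).symm

variable [IsStrictlyCommutativePicard P]

theorem nonempty_unit_hom {G : Type*} [AddCommGroup G] {X : G → P}
    (hX : ∀ a b c, a + b = c → Nonempty (X a ⊗ X b ⟶ X c)) : Nonempty (𝟙_ P ⟶ X 0) := by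
  obtain ⟨m⟩ := hX 0 0 0 (zero_add 0)
  exact ⟨(exists_whiskerRight_eq (X 0) ((λ_ (X 0)).hom ≫ inv m)).choose⟩

/-- A coherent family on a subgroup extends to the subgroup generated by an additional element. -/
theorem exists_extension {G : Type*} [AddCommGroup G] {X : G → P}
    (hX : ∀ a b c, a + b = c → Nonempty (X a ⊗ X b ⟶ X c)) (H : AddSubgroup G)
    (C : Coherent fun a : H => X a) (g : G) :
    ∃ (H' : AddSubgroup G) (hH : H ≤ H') (C' : Coherent fun a : H' => X a), g ∈ H' ∧
      ∀ (a b c : H) (h : a + b = c) (h' : (⟨a, hH a.2⟩ + ⟨b, hH b.2⟩ : H') = ⟨c, hH c.2⟩),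
        C'.μ _ _ _ h' = C.μ a b c h := by
  obtain ⟨ε₀⟩ := nonempty_unit_hom hX
  obtain ⟨D⟩ : Nonempty (Coherent fun n : ℤ => X (n • g)) :=
    exists_int (ε₀ ≫ eqToHom (by rw [zero_smul])) fun n m h =>
      (hX (n • g) ((1 : ℤ) • g) (m • g) (by rw [← add_smul, h])).some
  obtain ⟨ε, hε⟩ := D.exists_unit
  let q₀ : H × ℤ →+ G := H.subtype.coprod (zmultiplesHom G g)
  have hq₀ : ∀ b, q₀ b = b.1 + b.2 • g := fun b => rfl
  have := projective_ker H.subtype H.subtype_injective g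
  obtain ⟨u, hu⟩ := exists_trivialization ((C.prod D).pullback q₀.ker.subtype) (fun k => by
    obtain ⟨m⟩ : Nonempty (X k.1.1 ⊗ X (k.1.2 • g) ⟶ X 0) := hX _ _ _ k.2
    have v : 𝟙_ P ⟶ X k.1.1 ⊗ X (k.1.2 • g) := ε₀ ≫ inv m
    exact ⟨v⟩)
  have hker : ∀ k, q₀.rangeRestrict k = 0 → k ∈ q₀.ker := fun k hk => congrArg Subtype.val hk
  obtain ⟨D', κ, hκ⟩ := (C.prod D).exists_descent q₀.rangeRestrict q₀.rangeRestrict_surjective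
    (fun k hk => u ⟨k, hker k hk⟩)
    (fun a b c ha hb hc h => hu ⟨a, hker a ha⟩ ⟨b, hker b hb⟩ ⟨c, hker c hc⟩ (Subtype.ext h))
    (X := fun a : q₀.range => X a) (fun b => hX _ _ _ rfl)
  have hq : ∀ a : H, q₀ (a, 0) = a := fun a => by rw [hq₀, zero_smul, add_zero]
  have hH : H ≤ q₀.range := fun a ha => ⟨(⟨a, ha⟩, 0), hq _⟩
  -- On `H` the descended structure agrees with `C` only up to the automorphisms `χ a`.
  let χ : ∀ a : H, X a ⟶ X a := fun a =>
    ((ρ_ (X a)).inv ≫ X a ◁ ε) ≫ κ (a, 0) ⟨a, hH a.2⟩ (Subtype.ext (hq a))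
  have hχ : ∀ (a b c : H) (h : a + b = c)
      (h' : (⟨a, hH a.2⟩ + ⟨b, hH b.2⟩ : q₀.range) = ⟨c, hH c.2⟩),
      (χ a ⊗ₘ χ b) ≫ D'.μ _ _ _ h' = C.μ a b c h ≫ χ c := by
    intro a b c h h₁
    have h' : (a, (0 : ℤ)) + (b, 0) = (c, 0) := by rw [← h]; simp
    simp only [χ]
    rw [← tensorHom_comp_tensorHom, Category.assoc,
      hκ (a, 0) (b, 0) (c, 0) _ _ ⟨c, hH c.2⟩ h' _ _ _ (Subtype.ext (hq c)), ← Category.assoc,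
      tensorHom_unit_prod_μ C D hε a b c h h', Category.assoc]
  classical
  -- Transport along `ω` undoes `χ` over `H`, and any choice works elsewhere. Agreement with `C`
  -- becomes an equality, so that unions of chains make sense.
  let ω : ∀ a : q₀.range, X a ⟶ X a := fun a => if h : (a : G) ∈ H then inv (χ ⟨a, h⟩) else 𝟙 _
  have hω : ∀ a : H, ω ⟨a, hH a.2⟩ = inv (χ a) := fun a => dif_pos a.2
  refine ⟨q₀.range, hH, D'.transport ω, ⟨(0, 1), by simp [hq₀]⟩, fun a b c h h' => ?_⟩
  rw [← cancel_epi (ω ⟨a, hH a.2⟩ ⊗ₘ ω ⟨b, hH b.2⟩), tensorHom_transport_μ, hω, hω, hω,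
    ← cancel_epi (χ a ⊗ₘ χ b), ← Category.assoc, hχ a b c h, tensorHom_comp_tensorHom_assoc]
  simp

end Coherent

/-! ### Zorn's lemma -/

namespace Coherent

variable {P : Type u} [Category.{v} P] [MonoidalCategory P] [SymmetricCategory P]
  {G : Type*} [AddCommGroup G] {X : G → P}

theorem mk_add_mk_of_eq {H H' : AddSubgroup G} {a b c : H} (h : a + b = c) {ha : (a : G) ∈ H'}
    {hb : (b : G) ∈ H'} {hc : (c : G) ∈ H'} : (⟨a, ha⟩ + ⟨b, hb⟩ : H') = ⟨c, hc⟩ :=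
  Subtype.ext (congrArg (fun x : H => (x : G)) h)

/-- The extension relation between coherent structures on the restrictions of a family of objects to
subgroups. -/
def Extends (p q : Σ H : AddSubgroup G, Coherent fun a : H => X a) : Prop :=
  ∃ hH : p.1 ≤ q.1, ∀ (a b c : p.1) (h : a + b = c)
    (h' : (⟨a, hH a.2⟩ + ⟨b, hH b.2⟩ : q.1) = ⟨c, hH c.2⟩), q.2.μ _ _ _ h' = p.2.μ a b c h

theorem Extends.refl (p : Σ H : AddSubgroup G, Coherent fun a : H => X a) : Extends p p :=
  ⟨le_rfl, fun _ _ _ _ _ => rfl⟩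

theorem Extends.trans {p q r : Σ H : AddSubgroup G, Coherent fun a : H => X a}
    (h₁ : Extends p q) (h₂ : Extends q r) : Extends p r := by
  obtain ⟨l₁, e₁⟩ := h₁
  obtain ⟨l₂, e₂⟩ := h₂
  refine ⟨l₁.trans l₂, fun a b c h h' => ?_⟩
  have h'' : (⟨a, l₁ a.2⟩ + ⟨b, l₁ b.2⟩ : q.1) = ⟨c, l₁ c.2⟩ :=
    mk_add_mk_of_eq h
  rw [← e₁ a b c h h'', ← e₂ _ _ _ h'' h']

/-- The union of the chain works: members agree where they overlap, and each axiom involves at most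
three elements, which lie in a common member. -/
theorem exists_upperBound (c : Set (Σ H : AddSubgroup G, Coherent fun a : H => X a))
    (hc : IsChain Extends c) (hne : c.Nonempty) : ∃ ub, ∀ p ∈ c, Extends p ub := by
  have dir : ∀ p ∈ c, ∀ q ∈ c, ∃ r ∈ c, Extends p r ∧ Extends q r := by
    intro p hp q hq
    by_cases hpq : p = q
    · exact ⟨p, hp, Extends.refl p, hpq ▸ Extends.refl p⟩
    · rcases hc hp hq hpq with h | h
      exacts [⟨q, hq, h, Extends.refl q⟩, ⟨p, hp, Extends.refl p, h⟩]
  obtain ⟨p₀, hp₀⟩ := hne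
  let H : AddSubgroup G :=
    { carrier := {x | ∃ p ∈ c, x ∈ p.1}
      zero_mem' := ⟨p₀, hp₀, zero_mem _⟩
      neg_mem' := fun ⟨p, hp, h⟩ => ⟨p, hp, neg_mem h⟩
      add_mem' := fun ⟨p, hp, h⟩ ⟨q, hq, h'⟩ => by
        obtain ⟨r, hr, hpr, hqr⟩ := dir p hp q hq
        exact ⟨r, hr, add_mem (hpr.1 h) (hqr.1 h')⟩ }
  have two : ∀ a b : H, ∃ p ∈ c, (a : G) ∈ p.1 ∧ (b : G) ∈ p.1 := by
    rintro ⟨a, p, hp, ha⟩ ⟨b, q, hq, hb⟩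
    obtain ⟨r, hr, hpr, hqr⟩ := dir p hp q hq
    exact ⟨r, hr, hpr.1 ha, hqr.1 hb⟩
  have three : ∀ a b d : H, ∃ p ∈ c, (a : G) ∈ p.1 ∧ (b : G) ∈ p.1 ∧ (d : G) ∈ p.1 := by
    rintro a b ⟨d, q, hq, hd⟩
    obtain ⟨p, hp, ha, hb⟩ := two a b
    obtain ⟨r, hr, hpr, hqr⟩ := dir p hp q hq
    exact ⟨r, hr, hpr.1 ha, hpr.1 hb, hqr.1 hd⟩
  choose s hs ha hb using two
  have sum_mem : ∀ {p : Σ H : AddSubgroup G, Coherent fun a : H => X a} {a b d : H},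
      a + b = d → (a : G) ∈ p.1 → (b : G) ∈ p.1 → (d : G) ∈ p.1 := by
    rintro p a b _ rfl h h'
    exact add_mem h h'
  let μ : ∀ a b d : H, a + b = d → (X a ⊗ X b ⟶ X d) := fun a b d h =>
    (s a b).2.μ ⟨a, ha a b⟩ ⟨b, hb a b⟩ ⟨d, sum_mem h (ha a b) (hb a b)⟩
      (mk_add_mk_of_eq h)
  have key : ∀ p ∈ c, ∀ (a b d : H) (h : a + b = d) (ha' : (a : G) ∈ p.1) (hb' : (b : G) ∈ p.1)
      (hd' : (d : G) ∈ p.1) (h' : (⟨a, ha'⟩ + ⟨b, hb'⟩ : p.1) = ⟨d, hd'⟩),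
      μ a b d h = p.2.μ _ _ _ h' := by
    intro p hp a b d h ha' hb' hd' h'
    obtain ⟨r, hr, ⟨l₁, e₁⟩, ⟨l₂, e₂⟩⟩ := dir p hp (s a b) (hs a b)
    rw [← e₁ _ _ _ h' (mk_add_mk_of_eq h)]
    exact (e₂ _ _ _ _ _).symm
  refine ⟨⟨H, μ, ?_, ?_⟩, ?_⟩
  · intro x y z xy yz xyz hxy hyz h h'
    obtain ⟨p, hp, hx, hy, hz⟩ := three x y z
    have hxy' := sum_mem hxy hx hy
    have hyz' := sum_mem hyz hy hz
    have hxyz' := sum_mem h hxy' hz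
    rw [key p hp x y xy hxy hx hy hxy' (mk_add_mk_of_eq hxy),
      key p hp y z yz hyz hy hz hyz' (mk_add_mk_of_eq hyz),
      key p hp xy z xyz h hxy' hz hxyz' (mk_add_mk_of_eq h),
      key p hp x yz xyz h' hx hyz' hxyz' (mk_add_mk_of_eq h')]
    exact p.2.assoc ⟨x, hx⟩ ⟨y, hy⟩ ⟨z, hz⟩ ⟨xy, hxy'⟩ ⟨yz, hyz'⟩ ⟨xyz, hxyz'⟩ _ _ _ _
  · intro x y z h h'
    have hz := sum_mem h (ha x y) (hb x y)
    rw [key _ (hs x y) x y z h (ha x y) (hb x y) hz (mk_add_mk_of_eq h),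
      key _ (hs x y) y x z h' (hb x y) (ha x y) hz (mk_add_mk_of_eq h')]
    exact (s x y).2.comm ⟨x, ha x y⟩ ⟨y, hb x y⟩ ⟨z, hz⟩ _ _
  · intro p hp
    exact ⟨fun a h => ⟨p, hp, h⟩, fun a b d h h' => key p hp _ _ _ h' a.2 b.2 d.2 h⟩

/-- Every family of objects that is multiplicative up to isomorphism has a coherent structure. -/
theorem nonempty_coherent [IsStrictlyCommutativePicard P]
    (hX : ∀ a b c, a + b = c → Nonempty (X a ⊗ X b ⟶ X c)) : Nonempty (Coherent X) := by
  obtain ⟨ε₀⟩ := nonempty_unit_hom hX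
  -- Zorn starts at the trivial subgroup, with the constant unit family moved to `X 0`.
  have : Nonempty (Σ H : AddSubgroup G, Coherent fun a : H => X a) :=
    ⟨⟨⊥, (constUnit _ P).transport fun a =>
      ε₀ ≫ eqToHom (congrArg X (AddSubgroup.mem_bot.1 a.2).symm)⟩⟩
  obtain ⟨m, hm⟩ := exists_maximal_of_nonempty_chains_bounded
    (r := Extends (X := X)) exists_upperBound Extends.trans
  have top : ∀ g, g ∈ m.1 := fun g => by
    obtain ⟨H', hH, C', hg, h⟩ := exists_extension hX m.1 m.2 g
    exact (hm ⟨H', C'⟩ ⟨hH, h⟩).1 hg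
  exact ⟨m.2.pullback (AddMonoidHom.mk' (fun g => (⟨g, top g⟩ : m.1)) fun _ _ => rfl)⟩

end Coherent

/-! ### Symmetric monoidal equivalences -/

section Equivalence

open Functor.LaxMonoidal Functor.OplaxMonoidal

variable {C : Type u₁} [Category.{v₁} C] [MonoidalCategory C] [SymmetricCategory C]
  {D : Type u₂} [Category.{v₂} D] [MonoidalCategory D] [SymmetricCategory D]

/-- After applying the faithful `e.functor` and the counit, both sides become compatibility of
`e.functor` with the symmetry. -/
theorem inverse_braided (e : C ≌ D) [e.functor.Braided] [e.inverse.Monoidal] [e.IsMonoidal]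
    (X Y : D) : μ e.inverse X Y ≫ e.inverse.map (β_ X Y).hom =
      (β_ (e.inverse.obj X) (e.inverse.obj Y)).hom ≫ μ e.inverse Y X := by
  apply e.functor.map_injective
  have h : ∀ {X Y : D} (f : X ⟶ Y), e.functor.map (e.inverse.map f) ≫ e.counitIso.hom.app Y =
    e.counitIso.hom.app X ≫ f := fun f => e.counitIso.hom.naturality f
  rw [← cancel_mono (e.counitIso.hom.app (Y ⊗ X)), Functor.map_comp, Functor.map_comp,
    Category.assoc, Category.assoc, h,
    e.functor_map_μ_inverse_comp_counitIso_hom_app_tensor,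
    e.functor_map_μ_inverse_comp_counitIso_hom_app_tensor_assoc,
    BraidedCategory.braiding_naturality, Functor.map_braiding, Category.assoc, Category.assoc,
    Functor.Monoidal.μ_δ_assoc]

theorem isSymmetricMonoidalEquivalence_functor (e : C ≌ D) [e.functor.Braided] :
    IsSymmetricMonoidalEquivalence e.functor := by
  let _ : e.inverse.Monoidal := e.inverseMonoidal
  have _ : e.IsMonoidal := ⟨rfl, fun _ _ => rfl⟩
  let _ : e.inverse.Braided := { braided := inverse_braided e }
  exact ⟨e.inverse, inferInstance, e.unitIso.symm, e.counitIso,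
    inferInstanceAs (NatTrans.IsMonoidal (Iso.inv e.unitIso)),
    inferInstanceAs (NatTrans.IsMonoidal e.counit)⟩

/-- A symmetric monoidal functor which is an equivalence of categories is a symmetric monoidal
equivalence. -/
theorem isSymmetricMonoidalEquivalence_of_isEquivalence (F : C ⥤ D) [hF : F.Braided]
    [F.IsEquivalence] : IsSymmetricMonoidalEquivalence F :=
  @isSymmetricMonoidalEquivalence_functor C _ _ _ D _ _ _ F.asEquivalence hF

end Equivalence

/-! ### Scalars from the unit object -/

section Scalar

variable {C : Type u} [Category.{v} C] [MonoidalCategory C]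

/-- The action of the endomorphisms of the unit object on an object. -/
def unitScalar (a : 𝟙_ C ⟶ 𝟙_ C) (x : C) : x ⟶ x := (λ_ x).inv ≫ a ▷ x ≫ (λ_ x).hom

theorem unitScalar_naturality (a : 𝟙_ C ⟶ 𝟙_ C) {x y : C} (f : x ⟶ y) :
    f ≫ unitScalar a y = unitScalar a x ≫ f := by
  simp only [unitScalar, Category.assoc]
  rw [← leftUnitor_naturality, ← whisker_exchange_assoc, leftUnitor_inv_naturality_assoc]

theorem unitScalar_naturality_assoc (a : 𝟙_ C ⟶ 𝟙_ C) {x y z : C} (f : x ⟶ y) (g : y ⟶ z) :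
    f ≫ unitScalar a y ≫ g = unitScalar a x ≫ f ≫ g := by
  rw [reassoc_of% unitScalar_naturality a f]

theorem unitScalar_comp (a b : 𝟙_ C ⟶ 𝟙_ C) (x : C) :
    unitScalar (a ≫ b) x = unitScalar a x ≫ unitScalar b x := by
  simp [unitScalar]

theorem unitScalar_id (x : C) : unitScalar (𝟙 (𝟙_ C)) x = 𝟙 x := by
  simp [unitScalar]

theorem unitScalar_whiskerRight (a : 𝟙_ C ⟶ 𝟙_ C) (x y : C) :
    unitScalar a x ▷ y = unitScalar a (x ⊗ y) := by
  simp [unitScalar]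

/-- Scalars are natural, so the symmetry moves the claim to the other side of the tensor product. -/
theorem whiskerLeft_unitScalar [SymmetricCategory C] (a : 𝟙_ C ⟶ 𝟙_ C) (x y : C) :
    x ◁ unitScalar a y = unitScalar a (x ⊗ y) := by
  rw [← cancel_mono (β_ x y).hom, BraidedCategory.braiding_naturality_right,
    unitScalar_whiskerRight, unitScalar_naturality]

theorem unitScalar_bijective [SymmetricCategory C] [IsStrictlyCommutativePicard C] (x : C) :
    Function.Bijective fun a : 𝟙_ C ⟶ 𝟙_ C => unitScalar a x := by
  constructor
  · intro a b h
    have h' : (λ_ x).inv ≫ a ▷ x ≫ (λ_ x).hom = (λ_ x).inv ≫ b ▷ x ≫ (λ_ x).hom := h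
    rw [cancel_epi, cancel_mono] at h'
    exact whiskerRight_inj x h'
  · intro f
    obtain ⟨a, ha⟩ := exists_whiskerRight_eq x ((λ_ x).hom ≫ f ≫ (λ_ x).inv)
    exact ⟨a, by simp [unitScalar, ha]⟩

end Scalar

/-- The automorphism groups in an abelian groupoid are commutative. -/
instance autCommGroup {C : Type u} [Category.{v} C] [MonoidalCategory C]
    [SymmetricCategory C] [IsStrictlySymmetricAbelianGroupoid C] (x : C) : CommGroup (Aut x) where
  mul_comm f g := Iso.ext (IsStrictlySymmetricAbelianGroupoid.aut_comm x g.hom f.hom)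

/-- The group of isomorphism classes of a Picard category. -/
noncomputable instance skeletonCommGroup (P : Type u) [Category.{v} P] [MonoidalCategory P]
    [SymmetricCategory P] [IsStrictlyCommutativePicard P] : CommGroup (Skeleton P) :=
  have h : ∀ a : Skeleton P, ∃ b, b * a = 1 := fun a => by
    obtain ⟨y, ⟨f⟩⟩ := IsStrictlyCommutativePicard.exists_quasiInverse ((fromSkeleton P).obj a)
    refine ⟨toSkeleton y, ?_⟩
    rw [mul_comm]
    nth_rw 1 [← toSkeleton_fromSkeleton_obj a]
    rw [← Skeleton.toSkeleton_tensorObj, Skeleton.one_eq]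
    exact congr_toSkeleton_of_iso (asIso f)
  { Skeleton.instCommMonoid with
    inv := fun a => (h a).choose
    inv_mul_cancel := fun a => (h a).choose_spec }

/-! ### The functor attached to a coherent family -/

namespace Coherent

section

variable {P : Type u} [Category.{v} P] [MonoidalCategory P] [SymmetricCategory P]
  {B : Type*} [AddCommGroup B] {X : B → P} (C : Coherent X)

theorem μ_eqToHom {a b c c' : B} (h : a + b = c) (hc : X c = X c') (hc' : c = c') :
    C.μ a b c h ≫ eqToHom hc = C.μ a b c' (h.trans hc') := by
  subst hc'; simp

theorem eqToHom_whiskerRight_μ {a a' b c : B} (h : a' + b = c) (ha : X a = X a') (ha' : a = a') :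
    eqToHom ha ▷ X b ≫ C.μ a' b c h = C.μ a b c (by rw [ha', h]) := by
  subst ha'; simp

theorem whiskerLeft_eqToHom_μ {a b b' c : B} (h : a + b' = c) (hb : X b = X b') (hb' : b = b') :
    X a ◁ eqToHom hb ≫ C.μ a b' c h = C.μ a b c (by rw [hb', h]) := by
  subst hb'; simp

end

section Functor

variable {P : Type u} [Category.{v} P] [MonoidalCategory P] [SymmetricCategory P]
  [IsStrictlyCommutativePicard P] {G : Type*} [CommGroup G] {X : Additive G → P}

/-- The functor from `S(G, A, 0)`, with `A` the group of automorphisms of the unit object, that is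
defined by a family of objects indexed by `G`. -/
def sgaFunctor (X : Additive G → P) : SGA G (Additive (Aut (𝟙_ P))) ⥤ P where
  obj a := X (Additive.ofMul a.elt)
  map f := unitScalar f.val.toMul.hom _ ≫ eqToHom (congrArg (fun g => X (Additive.ofMul g)) f.eq)
  map_id a := by
    have h : (𝟙 a : a ⟶ a).val.toMul.hom = 𝟙 (𝟙_ P) := rfl
    rw [h, unitScalar_id, eqToHom_refl, Category.id_comp]
  map_comp f g := by
    -- Multiplication in `Aut` reverses composition, which matches the order `g.val + f.val` in
    -- `SGA`.
    have h : (f ≫ g).val.toMul.hom = f.val.toMul.hom ≫ g.val.toMul.hom := rfl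
    rw [h, unitScalar_comp, Category.assoc, Category.assoc, ← Category.assoc (eqToHom _),
      unitScalar_naturality]
    simp

theorem sgaFunctor_map {a b : SGA G (Additive (Aut (𝟙_ P)))} (f : a ⟶ b) :
    (sgaFunctor X).map f = unitScalar f.val.toMul.hom _ ≫
      eqToHom (congrArg (fun g => X (Additive.ofMul g)) f.eq) := rfl

theorem sgaFunctor_map_of_val_eq_zero {a b : SGA G (Additive (Aut (𝟙_ P)))} (f : a ⟶ b)
    (hf : f.val = 0) : (sgaFunctor X).map f =
      eqToHom (congrArg (fun g => X (Additive.ofMul g)) f.eq) := by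
  have h : f.val.toMul.hom = 𝟙 _ := by rw [hf]; rfl
  rw [sgaFunctor_map, h, unitScalar_id, Category.id_comp]

/-- The multiplication of a coherent family as an isomorphism. -/
noncomputable def μIso (C : Coherent X) (a b c : Additive G) (h : a + b = c) : X a ⊗ X b ≅ X c :=
  asIso (C.μ a b c h)

/-- The monoidal structure on `sgaFunctor` given by a coherent structure. -/
noncomputable def sgaCoreMonoidal (C : Coherent X) (ε : 𝟙_ P ≅ X 0)
    (hε : ∀ a, ε.hom ▷ X a ≫ C.μ 0 a a (zero_add a) = (λ_ (X a)).hom) :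
    (sgaFunctor X).CoreMonoidal where
  εIso := ε
  μIso a b := C.μIso (Additive.ofMul a.elt) (Additive.ofMul b.elt)
    (Additive.ofMul (a.elt * b.elt)) rfl
  μIso_hom_natural_left {a b} f c := by
    have h : (unitScalar f.val.toMul.hom (X (Additive.ofMul a.elt)) ≫
        eqToHom (congrArg (fun g => X (Additive.ofMul g)) f.eq)) ▷ X (Additive.ofMul c.elt) ≫
        C.μ (Additive.ofMul b.elt) (Additive.ofMul c.elt) (Additive.ofMul (b.elt * c.elt)) rfl =
      C.μ (Additive.ofMul a.elt) (Additive.ofMul c.elt) (Additive.ofMul (a.elt * c.elt)) rfl ≫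
        unitScalar f.val.toMul.hom _ ≫
        eqToHom (congrArg (fun g => X (Additive.ofMul (g * c.elt))) f.eq) := by
      rw [comp_whiskerRight_assoc, C.eqToHom_whiskerRight_μ _ _ (congrArg Additive.ofMul f.eq),
        unitScalar_naturality_assoc,
        C.μ_eqToHom _ _ (congrArg (fun g => Additive.ofMul (g * c.elt)) f.eq),
        unitScalar_whiskerRight]
    exact h
  μIso_hom_natural_right {a b} c f := by
    have h : X (Additive.ofMul c.elt) ◁ (unitScalar f.val.toMul.hom (X (Additive.ofMul a.elt)) ≫
        eqToHom (congrArg (fun g => X (Additive.ofMul g)) f.eq)) ≫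
        C.μ (Additive.ofMul c.elt) (Additive.ofMul b.elt) (Additive.ofMul (c.elt * b.elt)) rfl =
      C.μ (Additive.ofMul c.elt) (Additive.ofMul a.elt) (Additive.ofMul (c.elt * a.elt)) rfl ≫
        unitScalar f.val.toMul.hom _ ≫
        eqToHom (congrArg (fun g => X (Additive.ofMul (c.elt * g))) f.eq) := by
      rw [MonoidalCategory.whiskerLeft_comp_assoc,
        C.whiskerLeft_eqToHom_μ _ _ (congrArg Additive.ofMul f.eq), unitScalar_naturality_assoc,
        C.μ_eqToHom _ _ (congrArg (fun g => Additive.ofMul (c.elt * g)) f.eq),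
        whiskerLeft_unitScalar]
    exact h
  associativity a b c := by
    rw [sgaFunctor_map_of_val_eq_zero _ (SGA.associator_hom_val a b c)]
    -- The constraints of `SGA` become `eqToHom`s in `P`, which the freedom in the sum index of
    -- `C.μ` absorbs.
    have h : ∀ (x y z : Additive G) (e : X (x + y + z) = X (x + (y + z))),
        C.μ x y _ rfl ▷ X z ≫ C.μ (x + y) z _ rfl ≫ eqToHom e =
          (α_ (X x) (X y) (X z)).hom ≫ X x ◁ C.μ y z _ rfl ≫ C.μ x (y + z) _ rfl := by
      intro x y z e
      rw [C.μ_eqToHom _ e (add_assoc x y z), C.assoc x y z _ _ _ rfl]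
    exact h (Additive.ofMul a.elt) (Additive.ofMul b.elt) (Additive.ofMul c.elt) _
  left_unitality a := by
    rw [sgaFunctor_map_of_val_eq_zero _ (SGA.leftUnitor_hom_val a)]
    have h : ∀ (x : Additive G) (e : X (0 + x) = X x),
        (λ_ (X x)).hom = ε.hom ▷ X x ≫ C.μ 0 x _ rfl ≫ eqToHom e := by
      intro x e
      rw [C.μ_eqToHom _ e (zero_add x), hε]
    exact h (Additive.ofMul a.elt) _
  right_unitality a := by
    rw [sgaFunctor_map_of_val_eq_zero _ (SGA.rightUnitor_hom_val a)]
    have h : ∀ (x : Additive G) (e : X (x + 0) = X x),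
        (ρ_ (X x)).hom = X x ◁ ε.hom ≫ C.μ x 0 _ rfl ≫ eqToHom e := by
      intro x e
      rw [C.μ_eqToHom _ e (add_zero x), C.unit_right hε]
    exact h (Additive.ofMul a.elt) _

theorem nonempty_sgaFunctor_braided (C : Coherent X) : Nonempty (sgaFunctor X).Braided := by
  obtain ⟨ε, hε⟩ := C.exists_unit
  let _ : (sgaFunctor X).Monoidal := (C.sgaCoreMonoidal (asIso ε) hε).toMonoidal
  refine ⟨{ braided := fun a b => ?_ }⟩
  rw [sgaFunctor_map_of_val_eq_zero _ (SGA.braiding_hom_val a b)]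
  have h : ∀ (x y : Additive G) (e : X (x + y) = X (y + x)),
      C.μ x y _ rfl ≫ eqToHom e = (β_ (X x) (X y)).hom ≫ C.μ y x _ rfl := by
    intro x y e
    rw [C.μ_eqToHom _ e (add_comm x y), C.comm x y _ (add_comm x y)]
  exact h (Additive.ofMul a.elt) (Additive.ofMul b.elt) _

/-- Bijectivity of scalars gives full faithfulness, since `hX` rules out arrows between different
indices. -/
theorem sgaFunctor_isEquivalence (hX : ∀ a b, Nonempty (X a ⟶ X b) → a = b)
    (hX' : ∀ p, ∃ a, Nonempty (X a ⟶ p)) : (sgaFunctor X).IsEquivalence where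
  faithful :=
    { map_injective := fun {a b} f g h => by
        have h' := (cancel_mono (eqToHom (congrArg (fun g => X (Additive.ofMul g)) f.eq))).1 h
        have h'' := (unitScalar_bijective _).1 h'
        exact SGA.hom_ext (congrArg Additive.ofMul (Iso.ext h'')) }
  full :=
    { map_surjective := fun {a b} f => by
        let f' : X (Additive.ofMul a.elt) ⟶ X (Additive.ofMul b.elt) := f
        have e : a.elt = b.elt := congrArg Additive.toMul (hX _ _ ⟨f'⟩)
        have e' := congrArg (fun g => X (Additive.ofMul g)) e
        obtain ⟨v, hv⟩ := (unitScalar_bijective (X (Additive.ofMul a.elt))).2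
          (f' ≫ eqToHom e'.symm)
        have h : unitScalar v (X (Additive.ofMul a.elt)) ≫ eqToHom e' = f' := by
          simp only at hv
          rw [hv, Category.assoc, eqToHom_trans, eqToHom_refl, Category.comp_id]
        exact ⟨⟨e, Additive.ofMul (asIso v : Aut (𝟙_ P))⟩, h⟩ }
  essSurj :=
    { mem_essImage := fun p => by
        obtain ⟨a, ⟨f⟩⟩ := hX' p
        let i : X a ≅ p := asIso f
        exact ⟨⟨a.toMul⟩, ⟨i⟩⟩ }

end Functor

end Coherent

theorem IsStrictlyCommutativePicard.exists_symmetricMonoidalEquivalent_sga (P : Type u)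
    [Category.{v} P] [MonoidalCategory P] [SymmetricCategory P] [IsStrictlyCommutativePicard P] :
    SymmetricMonoidalEquivalent (SGA (Skeleton P) (Additive (Aut (𝟙_ P)))) P := by
  let X : Additive (Skeleton P) → P := fun a => (fromSkeleton P).obj a.toMul
  have hX : ∀ a, toSkeleton (X a) = a.toMul := fun a => toSkeleton_fromSkeleton_obj _
  obtain ⟨C⟩ : Nonempty (Coherent X) := Coherent.nonempty_coherent fun a b c h => by
    have e : toSkeleton (X a ⊗ X b) = toSkeleton (X c) := by
      rw [Skeleton.toSkeleton_tensorObj, hX, hX, hX, ← h, toMul_add]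
    exact ⟨(Skeleton.isoOfEq e).hom⟩
  obtain ⟨hB⟩ := C.nonempty_sgaFunctor_braided
  have := Coherent.sgaFunctor_isEquivalence (X := X)
    (fun a b ⟨f⟩ => by
      have h := congr_toSkeleton_of_iso (asIso f)
      rwa [hX, hX] at h)
    (fun p => ⟨Additive.ofMul (toSkeleton p), ⟨(fromSkeletonToSkeletonIso p).hom⟩⟩)
  exact ⟨_, hB, isSymmetricMonoidalEquivalence_of_isEquivalence _⟩

theorem SymmetricMonoidalEquivalent.exists_isEquivalence {C : Type u₁} [Category.{v₁} C]
    [MonoidalCategory C] [SymmetricCategory C] {D : Type u₂} [Category.{v₂} D] [MonoidalCategory D]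
    [SymmetricCategory D] (h : SymmetricMonoidalEquivalent C D) :
    ∃ (F : C ⥤ D) (_ : F.Braided), F.IsEquivalence := by
  obtain ⟨F, hF, F', _, θ, θ', _, _⟩ := h
  exact ⟨F, hF, (CategoryTheory.Equivalence.mk F F' θ.symm θ').isEquivalence_functor⟩

/-! ### Classification of the categories `S(G, A, 0)` -/

namespace SGA

variable {G : Type u₁} {G' : Type u₂} {A : Type v₁} {A' : Type v₂} [CommGroup G] [CommGroup G']
  [AddCommGroup A] [AddCommGroup A']

/-- The functor `S(G, A, 0) ⥤ S(G', A', 0)` induced by a pair of homomorphisms. -/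
def mapFunctor (f : G →* G') (g : A →+ A') : SGA G A ⥤ SGA G' A' where
  obj a := ⟨f a.elt⟩
  map u := ⟨congrArg f u.eq, g u.val⟩
  map_id a := by ext; exact map_zero g
  map_comp u v := by ext; exact map_add g v.val u.val

theorem mapFunctor_map_val (f : G →* G') (g : A →+ A') {a b : SGA G A} (u : a ⟶ b) :
    ((mapFunctor f g).map u).val = g u.val := rfl

/-- The monoidal structure on `mapFunctor`, given by identities. -/
def mapFunctorCoreMonoidal (f : G →* G') (g : A →+ A') : (mapFunctor f g).CoreMonoidal where
  εIso := isoZero (map_one f).symm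
  μIso a b := isoZero (map_mul f a.elt b.elt).symm
  μIso_hom_natural_left u c := by
    ext; exact (zero_add (g u.val)).trans (add_zero (g u.val)).symm
  μIso_hom_natural_right c u := by
    ext; exact (zero_add (g u.val)).trans (add_zero (g u.val)).symm
  associativity a b c := by ext; simp [mapFunctor_map_val]; rfl
  left_unitality a := by ext; simp [mapFunctor_map_val]; exact (add_zero (0 : A')).symm
  right_unitality a := by ext; simp [mapFunctor_map_val]; exact (add_zero (0 : A')).symm

instance (f : G →* G') (g : A →+ A') : (mapFunctor f g).Monoidal :=
  (mapFunctorCoreMonoidal f g).toMonoidal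

theorem mapFunctor_μ_val (f : G →* G') (g : A →+ A') (a b : SGA G A) :
    (Functor.LaxMonoidal.μ (mapFunctor f g) a b).val = 0 := rfl

instance (f : G →* G') (g : A →+ A') : (mapFunctor f g).Braided where
  braided a b := by ext; simp [mapFunctor_map_val, mapFunctor_μ_val]

theorem mapFunctor_isEquivalence (f : G ≃* G') (g : A ≃+ A') :
    (mapFunctor (f : G →* G') (g : A →+ A')).IsEquivalence where
  faithful := { map_injective := fun h => hom_ext (g.injective (congrArg Hom.val h)) }
  full := { map_surjective := fun u =>
    ⟨⟨f.injective u.eq, g.symm u.val⟩, hom_ext (g.apply_symm_apply _)⟩ }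
  essSurj := { mem_essImage := fun a => ⟨⟨f.symm a.elt⟩, ⟨isoZero (f.apply_symm_apply _)⟩⟩ }

/-- The homomorphism between the groups of objects induced by a monoidal functor. -/
def objHom (F : SGA G A ⥤ SGA G' A') [F.Monoidal] : G →* G' :=
  MonoidHom.mk' (fun a => (F.obj ⟨a⟩).elt) fun a b =>
    (Functor.LaxMonoidal.μ F (⟨a⟩ : SGA G A) ⟨b⟩).eq.symm

/-- The homomorphism between the groups of endomorphisms of the units induced by a functor. -/
def endHom (F : SGA G A ⥤ SGA G' A') : A →+ A' :=
  AddMonoidHom.mk' (fun v => (F.map (⟨rfl, v⟩ : 𝟙_ (SGA G A) ⟶ 𝟙_ (SGA G A))).val) fun v w =>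
    congrArg Hom.val (F.map_comp (⟨rfl, w⟩ : 𝟙_ (SGA G A) ⟶ 𝟙_ (SGA G A))
      (⟨rfl, v⟩ : 𝟙_ (SGA G A) ⟶ 𝟙_ (SGA G A)))

/-- An arrow forces its ends to be equal, so fullness yields injectivity and essential surjectivity
yields surjectivity. -/
theorem objHom_bijective (F : SGA G A ⥤ SGA G' A') [F.Monoidal] [F.IsEquivalence] :
    Function.Bijective (objHom F) := by
  constructor
  · intro a b h
    exact (F.preimage (⟨h, 0⟩ : F.obj (⟨a⟩ : SGA G A) ⟶ F.obj ⟨b⟩)).eq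
  · intro b
    exact ⟨(F.objPreimage ⟨b⟩).elt, (F.objObjPreimageIso ⟨b⟩).hom.eq⟩

theorem endHom_bijective (F : SGA G A ⥤ SGA G' A') [F.IsEquivalence] :
    Function.Bijective (endHom F) := by
  constructor
  · intro v w h
    exact congrArg Hom.val (F.map_injective (hom_ext h))
  · intro w
    obtain ⟨u, hu⟩ := F.map_surjective
      (⟨rfl, w⟩ : F.obj (𝟙_ (SGA G A)) ⟶ F.obj (𝟙_ (SGA G A)))
    exact ⟨u.val, congrArg Hom.val hu⟩

theorem symmetricMonoidalEquivalent_iff :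
    SymmetricMonoidalEquivalent (SGA G A) (SGA G' A') ↔
      Nonempty (G ≃* G') ∧ Nonempty (A ≃+ A') := by
  constructor
  · intro h
    obtain ⟨F, _, _⟩ := h.exists_isEquivalence
    exact ⟨⟨MulEquiv.ofBijective _ (objHom_bijective F)⟩,
      ⟨AddEquiv.ofBijective _ (endHom_bijective F)⟩⟩
  · rintro ⟨⟨f⟩, ⟨g⟩⟩
    have := mapFunctor_isEquivalence f g
    exact ⟨mapFunctor f g, inferInstance, isSymmetricMonoidalEquivalence_of_isEquivalence _⟩

end SGA

theorem corollary3p3 :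
    (∀ (P : Type u) [Category.{v} P] [MonoidalCategory P] [SymmetricCategory P]
      [IsStrictlyCommutativePicard P],
      ∃ (G : Type u) (A : Type v) (_ : CommGroup G) (_ : AddCommGroup A),
        SymmetricMonoidalEquivalent (SGA G A) P) ∧
    (∀ (G : Type u₁) (G' : Type u₂) (A : Type v₁) (A' : Type v₂) [CommGroup G] [CommGroup G']
      [AddCommGroup A] [AddCommGroup A'],
      SymmetricMonoidalEquivalent (SGA G A) (SGA G' A') ↔
        Nonempty (G ≃* G') ∧ Nonempty (A ≃+ A')) :=
  ⟨fun P _ _ _ _ => ⟨_, _, _, _,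
    IsStrictlyCommutativePicard.exists_symmetricMonoidalEquivalent_sga P⟩,
    fun _ _ _ _ _ _ _ _ => SGA.symmetricMonoidalEquivalent_iff⟩
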